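/- Let $X$ be a complex Banach space, let $n,m,r\ge 1$ be integers, let $t_1<\dots<t_m$ be real numbers, let $a_{jk}$ ($1\le j\le m$, $0\le k\le n$) be complex $r\times r$ matrices, and let $f:\mathbb R\to X^r$. Consider the system $$\sum_{k=0}^{n}\sum_{j=1}^{m}a_{jk}\,y^{(k)}(t+t_j)=f(t). \qquad (1)$$ A solution of (1) is a function $y\in W^{1,n}_{loc}(\mathbb R,X^r)$ satisfying (1) for almost every $t\in\mathbb R$; here $y\in W^{1,n}_{loc}$ means that $y$ is $(n-1)$ times continuously differentiable and $y^{(n-1)}$ is an indefinite integral of a locally Bochner integrable function $y^{(n)}$. Write $C_u$ for the set of uniformly continuous (not necessarily bounded) functions $\mathbb R\to X^r$. A function $g:\mathbb R\to X^r$ is recurrent, $g\in REC$, if it is continuous and for every compact $K\subset\mathbb R$ and every $\varepsilon>0$ the set $E=\{\tau\in\mathbb R:\|g(t+\tau)-g(t)\|\le\varepsilon\text{ for all }t\in K\}$ is relatively dense, i.e. $E+L=\mathbb R$ for some compact $L\subset\mathbb R$. For a set $\mathcal A$ of functions $\mathbb R\to X^r$ let $$\mathcal M\mathcal A=\Big\{g\in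 L^1_{loc}(\mathbb R,X^r):\ \frac1h\int_0^h g(\cdot+s)\,ds\in\mathcal A\ \text{ for all } h>0\Big\},$$ $\mathcal M^0\mathcal A=\mathcal A\cap L^1_{loc}(\mathbb R,X^r)$ and $\mathcal M^{k+1}\mathcal A=\mathcal M(\mathcal M^{k}\mathcal A)$. **Proposition.** Assume that $$\det\sum_{j=1}^m a_{jn}e^{i\omega t_j}\ne 0\quad\text{for all }\omega\in\mathbb R,$$ that for some index $j_0$ one has $t_{j_0}=0$ and $a_{jn}=0$ for all $j\ne j_0$, and that $f\in\mathcal M C_u$. Let $y$ be a solution of (1) such that $y\in\mathcal M^{s}C_u\cap\mathcal M^{s^*}REC$ for some integers $s,s^*\ge 0$. Then $y^{(k)}\in REC$ for $0\le k<n$, and $y^{(n)}\in\mathcal M\,REC$. -/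

import Mathlib

open MeasureTheory
open scoped Pointwise

namespace RecurrentSolutions

section Recurrent

variable {G : Type*} [AddCommGroup G] [TopologicalSpace G] {E : Type*} [NormedAddCommGroup E]

/-- A subset `S` of a topological abelian group is relatively dense if `S + L = G` for some
compact `L`. -/
def IsRelativelyDense (S : Set G) : Prop :=
  ∃ L : Set G, IsCompact L ∧ S + L = Set.univ

/-- The set of `ε`-`K`-periods of `f`. -/
def almostPeriods (f : G → E) (ε : ℝ) (K : Set G) : Set G :=
  {τ | ∀ t ∈ K, ‖f (t + τ) - f t‖ ≤ ε}

/-- `f` is recurrent: it is continuous, and for all compact `K` and `ε > 0` its set of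
`ε`-`K`-periods is relatively dense. -/
def IsRecurrent (f : G → E) : Prop :=
  Continuous f ∧
    ∀ K : Set G, IsCompact K → ∀ ε : ℝ, 0 < ε → IsRelativelyDense (almostPeriods f ε K)

end Recurrent

/-- The class `REC(ℝ, E)` of recurrent functions on the real line. -/
def REC (E : Type*) [NormedAddCommGroup E] : Set (ℝ → E) :=
  {f | IsRecurrent f}

/-- The class `C_u(ℝ, E)` of uniformly continuous functions (not assumed bounded). -/
def Cu (E : Type*) [NormedAddCommGroup E] : Set (ℝ → E) :=
  {f | UniformContinuous f}

section Means

variable {E : Type*} [NormedAddCommGroup E] [NormedSpace ℝ E]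

/-- The mean `M_h f (t) = (1/h) ∫_0^h f (t + s) ds`. -/
noncomputable def mean (h : ℝ) (f : ℝ → E) : ℝ → E :=
  fun t => (1 / h) • ∫ s in (0 : ℝ)..h, f (t + s)

/-- `M A`: the locally (Bochner) integrable functions all of whose means `M_h f`, `h > 0`,
belong to `A`. -/
def meanClass (A : Set (ℝ → E)) : Set (ℝ → E) :=
  {f | LocallyIntegrable f volume ∧ ∀ h : ℝ, 0 < h → mean h f ∈ A}

/-- The iterates: `M^0 A = A ∩ L^1_loc` and `M^(k+1) A = M (M^k A)`. -/
def meanClassIter : ℕ → Set (ℝ → E) → Set (ℝ → E)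
  | 0, A => A ∩ {f | LocallyIntegrable f volume}
  | k + 1, A => meanClass (meanClassIter k A)

/-- The local Sobolev space `W^{1,n}_loc(ℝ, E)`, for everywhere defined functions: `y` is locally
integrable and, for each `k < n`, `y^(k)` is an indefinite integral of the locally integrable
function `y^(k+1)`. Thus, for `n ≥ 1`, `y` is the continuous representative, `y` is `C^(n-1)` with
classical derivatives, and `y^(n)`, which is determined almost everywhere, is the almost everywhere
existing derivative of the locally absolutely continuous function `y^(n-1)` (`iteratedDeriv n y`
is `0` on the null set where that derivative does not exist). -/
def MemSobolevLoc (n : ℕ) (y : ℝ → E) : Prop :=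
  LocallyIntegrable y volume ∧
    ∀ k < n, LocallyIntegrable (iteratedDeriv (k + 1) y) volume ∧
      ∀ a b : ℝ, iteratedDeriv k y b - iteratedDeriv k y a =
        ∫ t in a..b, iteratedDeriv (k + 1) y t

end Means

section System

variable {X : Type*} [NormedAddCommGroup X] [NormedSpace ℂ X] {n m r : ℕ}

/-- The action of a complex `r × r` matrix on column vectors with entries in `X`. -/
def matrixAct (A : Matrix (Fin r) (Fin r) ℂ) (v : Fin r → X) : Fin r → X :=
  fun i => ∑ l, A i l • v l

/-- `y` is a solution of `∑_{k ≤ n} ∑_j a_{jk} y^(k)(t + t_j) = f(t)`: it belongs to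
`W^{1,n}_loc` and satisfies the equation almost everywhere on `ℝ`. -/
def IsSolution (t : Fin m → ℝ) (a : Fin m → Fin (n + 1) → Matrix (Fin r) (Fin r) ℂ)
    (f y : ℝ → Fin r → X) : Prop :=
  MemSobolevLoc n y ∧
    ∀ᵐ x : ℝ, ∑ k : Fin (n + 1), ∑ j : Fin m,
      matrixAct (a j k) (iteratedDeriv (k : ℕ) y (x + t j)) = f x

/-- The nondegeneracy condition `det ∑_j a_{jn} e^{i ω t_j} ≠ 0` for all real `ω`. -/
def LeadingNondegenerate (t : Fin m → ℝ)
    (a : Fin m → Fin (n + 1) → Matrix (Fin r) (Fin r) ℂ) : Prop :=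
  ∀ ω : ℝ, (∑ j : Fin m,
    Complex.exp (Complex.I * (ω : ℂ) * (t j : ℂ)) • a j (Fin.last n)).det ≠ 0

end System

end RecurrentSolutions

/-!
The proof separates regularity from recurrence; the right-hand side `f` matters only for regularity.

Regularity: `y, …, y^(n-1)` are uniformly continuous. If `u` is an indefinite integral of `v`, the
means of `v` are difference quotients of `u`. Hence differentiation raises the order `p` in
`M^p C_u` by at most one, and all `y^(k)`, `k ≤ n`, lie in some common `M^p C_u`. This order is
brought down again. When `u` and `v` lie in `M^(p+1) C_u`, the differences of `u` lie in `M^p C_u`,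
and then so does `u` itself (`mem_meanClassIter_Cu_of_diff`); this treats `y^(k)` for `k < n`. The
leading coefficient of the system is the single matrix `a_{j₀ n}`, which is invertible, so `y^(n)`
is almost everywhere a combination of `f` and of translates of lower derivatives, and it inherits
their order as long as that order is at least `1`. The analytic core is the case `p = 0`
(`uniformContinuous_of_mean_of_diff`): a continuous function with uniformly continuous mean and
differences is uniformly continuous. There Baire's theorem makes the uniform continuity of the
differences uniform for steps in `[0, 1]` (`exists_uniform_modulus`), so that it survives the
integration in `M_1 u - u = ∫_0^1 (u(· + s) - u) ds`.

Recurrence: a uniformly continuous function is the uniform limit of its means, and recurrence is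
closed under uniform limits, so a uniformly continuous function with recurrent iterated means is
recurrent (`mem_REC_of_mem_meanClassIter`). This gives `y ∈ REC`. The means of `y^(k+1)` are
difference quotients of `y^(k)`. Recurrent functions do not form a vector space, but a combination
of translates of one recurrent function is recurrent (`IsRecurrent.const_smul_diff`), and so
recurrence passes from each derivative to the next.
-/

namespace RecurrentSolutions

variable {E : Type*} [NormedAddCommGroup E]

/-! ### Recurrent functions -/

theorem IsRelativelyDense.mono {S T : Set ℝ} (hS : IsRelativelyDense S) (h : S ⊆ T) :
    IsRelativelyDense T := by
  obtain ⟨L, hL, hSL⟩ := hS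
  exact ⟨L, hL, Set.univ_subset_iff.1 (hSL ▸ Set.add_subset_add_right h)⟩

theorem IsRecurrent.const_smul_diff [NormedSpace ℝ E] {u : ℝ → E} (hu : IsRecurrent u)
    (c h : ℝ) : IsRecurrent fun t => c • (u (t + h) - u t) := by
  refine ⟨by have := hu.1; fun_prop, fun K hK ε hε => ?_⟩
  -- A common period on `K` and on `K + h` controls both translates at once.
  have hK' : IsCompact (K ∪ (fun t => t + h) '' K) := hK.union (hK.image (by fun_prop))
  have hc : 0 < ε / (2 * (|c| + 1)) := by positivity
  refine (hu.2 _ hK' _ hc).mono fun τ hτ t ht => ?_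
  have h1 := hτ t (Or.inl ht)
  have h2 := hτ (t + h) (Or.inr ⟨t, ht, rfl⟩)
  rw [add_right_comm] at h2
  have e : c • (u (t + τ + h) - u (t + τ)) - c • (u (t + h) - u t)
      = c • ((u (t + τ + h) - u (t + h)) - (u (t + τ) - u t)) := by
    rw [← smul_sub]; congr 1; abel
  rw [e, norm_smul, Real.norm_eq_abs]
  calc |c| * ‖(u (t + τ + h) - u (t + h)) - (u (t + τ) - u t)‖
      ≤ (|c| + 1) * (ε / (2 * (|c| + 1)) + ε / (2 * (|c| + 1))) := by
        gcongr
        · linarith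
        · exact (norm_sub_le _ _).trans (add_le_add h2 h1)
    _ = ε := by field_simp; ring

/-- Recurrence passes to uniform limits. -/
theorem isRecurrent_of_uniform_approx {u : ℝ → E}
    (h : ∀ ε : ℝ, 0 < ε → ∃ v, IsRecurrent v ∧ ∀ t, ‖u t - v t‖ ≤ ε) : IsRecurrent u := by
  refine ⟨?_, fun K hK ε hε => ?_⟩
  · refine continuous_of_uniform_approx_of_continuous fun s hs => ?_
    obtain ⟨ε, hε, hs⟩ := Metric.mem_uniformity_dist.1 hs
    obtain ⟨v, hv, huv⟩ := h (ε / 2) (by positivity)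
    exact ⟨v, hv.1, fun t => hs (by rw [dist_eq_norm]; linarith [huv t])⟩
  · obtain ⟨v, hv, huv⟩ := h (ε / 3) (by positivity)
    refine (hv.2 K hK (ε / 3) (by positivity)).mono fun τ hτ t ht => ?_
    have e : u (t + τ) - u t
        = (u (t + τ) - v (t + τ)) + (v (t + τ) - v t) - (u t - v t) := by abel
    rw [e]
    calc _ ≤ ‖u (t + τ) - v (t + τ)‖ + ‖v (t + τ) - v t‖ + ‖u t - v t‖ :=
          (norm_sub_le _ _).trans (by gcongr; exact norm_add_le _ _)
      _ ≤ ε / 3 + ε / 3 + ε / 3 := by gcongr <;> first | exact huv _ | exact hτ t ht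
      _ = ε := by ring

/-! ### Uniform continuity by translation -/

theorem uniformContinuous_of_shift {u : ℝ → E}
    (h : ∀ ε : ℝ, 0 < ε → ∃ η > 0, ∀ δ, |δ| ≤ η → ∀ t, ‖u (t + δ) - u t‖ ≤ ε) :
    UniformContinuous u := by
  rw [Metric.uniformContinuous_iff]
  intro ε hε
  obtain ⟨η, hη, H⟩ := h (ε / 2) (by positivity)
  refine ⟨η, hη, fun {a b} hab => ?_⟩
  have := H (a - b) (by rw [← Real.dist_eq]; exact hab.le) b
  rw [add_sub_cancel] at this
  rw [dist_eq_norm]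
  linarith

theorem shift_of_uniformContinuous {u : ℝ → E} (h : UniformContinuous u) {ε : ℝ} (hε : 0 < ε) :
    ∃ η > 0, ∀ δ, |δ| ≤ η → ∀ t, ‖u (t + δ) - u t‖ ≤ ε := by
  obtain ⟨η, hη, H⟩ := Metric.uniformContinuous_iff.1 h ε hε
  refine ⟨η / 2, by positivity, fun δ hδ t => ?_⟩
  rw [← dist_eq_norm]
  exact (H (by rw [Real.dist_eq, add_sub_cancel_left]; linarith)).le

/-- If all differences of a continuous `u` are uniformly continuous, then they are so uniformly
for steps in a compact set. By Baire's theorem the modulus is uniform for steps near some `a`; the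
second difference is subadditive in the step, so uniformity carries over to a neighbourhood of
every step `s₀`, since a step near `s₀` is `s₀` plus a difference of two steps near `a`. -/
theorem exists_uniform_modulus {u : ℝ → E} (hu : Continuous u)
    (hd : ∀ s : ℝ, 0 < s → UniformContinuous fun t => u (t + s) - u t) {K : Set ℝ}
    (hK : IsCompact K) {ε : ℝ} (hε : 0 < ε) :
    ∃ η > 0, ∀ s ∈ K, ∀ δ, |δ| ≤ η → ∀ t,
      ‖(u (t + s + δ) - u (t + s)) - (u (t + δ) - u t)‖ ≤ ε := by
  have hpt : ∀ s : ℝ, ∀ ε : ℝ, 0 < ε → ∃ η > 0, ∀ δ, |δ| ≤ η → ∀ t,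
      ‖(u (t + s + δ) - u (t + s)) - (u (t + δ) - u t)‖ ≤ ε := by
    intro s ε hε
    rcases lt_trichotomy s 0 with hs | rfl | hs
    · obtain ⟨η, hη, H⟩ := shift_of_uniformContinuous (hd (-s) (by linarith)) hε
      refine ⟨η, hη, fun δ hδ t => ?_⟩
      have := H δ hδ (t + s)
      rw [show t + s + δ + -s = t + δ by ring, show t + s + -s = t by ring] at this
      rw [← norm_neg]
      exact le_of_eq_of_le (congrArg _ (by abel)) this
    · exact ⟨1, one_pos, fun δ _ t => by simp [hε.le]⟩
    · obtain ⟨η, hη, H⟩ := shift_of_uniformContinuous (hd s hs) hε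
      refine ⟨η, hη, fun δ hδ t => ?_⟩
      have := H δ hδ t
      rw [add_right_comm t δ s] at this
      convert this using 2
      abel
  let F : ℕ → Set ℝ := fun N => {s | ∀ δ : ℝ, |δ| ≤ 1 / (N + 1 : ℝ) → ∀ t,
    ‖(u (t + s + δ) - u (t + s)) - (u (t + δ) - u t)‖ ≤ ε / 3}
  have hF : ∀ N, IsClosed (F N) := fun N => by
    simp only [F, Set.ofPred_forall]
    refine isClosed_iInter fun δ => isClosed_iInter fun _ => isClosed_iInter fun t => ?_
    exact isClosed_le (by fun_prop) continuous_const
  have hcov : ⋃ N, F N = Set.univ := by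
    refine Set.eq_univ_of_forall fun s => ?_
    obtain ⟨η, hη, H⟩ := hpt s (ε / 3) (by positivity)
    obtain ⟨N, hN⟩ := exists_nat_one_div_lt hη
    exact Set.mem_iUnion.2 ⟨N, fun δ hδ t => H δ (hδ.trans hN.le) t⟩
  obtain ⟨N, a, ha⟩ := nonempty_interior_of_iUnion_of_closed hF hcov
  obtain ⟨ρ, hρ, hball⟩ := Metric.mem_nhds_iff.1 (mem_interior_iff_mem_nhds.1 ha)
  refine hK.induction_on (p := fun S => ∃ η > 0, ∀ s ∈ S, ∀ δ, |δ| ≤ η → ∀ t,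
      ‖(u (t + s + δ) - u (t + s)) - (u (t + δ) - u t)‖ ≤ ε) ⟨1, one_pos, by simp⟩ ?_ ?_ ?_
  · rintro S T hST ⟨η, hη, H⟩
    exact ⟨η, hη, fun s hs => H s (hST hs)⟩
  · rintro S T ⟨η, hη, H⟩ ⟨η', hη', H'⟩
    refine ⟨min η η', lt_min hη hη', ?_⟩
    rintro s (hs | hs) δ hδ t
    · exact H s hs δ (hδ.trans (min_le_left _ _)) t
    · exact H' s hs δ (hδ.trans (min_le_right _ _)) t
  · intro s₀ _
    obtain ⟨η, hη, H⟩ := hpt s₀ (ε / 3) (by positivity)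
    refine ⟨Metric.ball s₀ ρ, mem_nhdsWithin_of_mem_nhds (Metric.ball_mem_nhds _ hρ),
      min η (1 / (N + 1 : ℝ)), lt_min hη (by positivity), fun s hs δ hδ t => ?_⟩
    have h1 := hball (show a + (s - s₀) ∈ Metric.ball a ρ by
      rw [Metric.mem_ball, Real.dist_eq] at hs ⊢; simpa using hs) δ
      (hδ.trans (min_le_right _ _)) (t + s₀ - a)
    have h2 := hball (Metric.mem_ball_self hρ) δ (hδ.trans (min_le_right _ _)) (t + s₀ - a)
    have h3 := H δ (hδ.trans (min_le_left _ _)) t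
    rw [show t + s₀ - a + (a + (s - s₀)) = t + s by ring] at h1
    rw [show t + s₀ - a + a = t + s₀ by ring] at h2
    generalize u (t + s₀ - a + δ) - u (t + s₀ - a) = z at h1 h2
    generalize u (t + s + δ) - u (t + s) = x at h1 ⊢
    generalize u (t + s₀ + δ) - u (t + s₀) = w at h2 h3
    generalize u (t + δ) - u t = v at h3 ⊢
    calc ‖x - v‖ = ‖(x - z) - (w - z) + (w - v)‖ := by congr 1; abel
      _ ≤ ‖x - z‖ + ‖w - z‖ + ‖w - v‖ :=
        (norm_add_le _ _).trans (by gcongr; exact norm_sub_le _ _)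
      _ ≤ ε / 3 + ε / 3 + ε / 3 := by gcongr
      _ = ε := by ring

/-! ### Means -/

theorem intervalIntegrable_of_locallyIntegrable {g : ℝ → E} (hg : LocallyIntegrable g volume)
    (a b : ℝ) : IntervalIntegrable g volume a b :=
  (hg.integrableOn_isCompact isCompact_uIcc).intervalIntegrable

theorem locallyIntegrable_translate {g : ℝ → E} (hg : LocallyIntegrable g volume) (c : ℝ) :
    LocallyIntegrable (fun t => g (t + c)) volume := by
  rw [locallyIntegrable_iff]
  intro K hK
  have := (measurePreserving_add_right volume c).integrableOn_comp_preimage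
    (Homeomorph.addRight c).measurableEmbedding (f := g) (s := (fun t => t + c) '' K)
  have h2 := this.2 (hg.integrableOn_isCompact (hK.image (by fun_prop)))
  exact h2.mono_set (Set.subset_preimage_image _ _)

theorem intervalIntegrable_shift {g : ℝ → E} (hg : LocallyIntegrable g volume)
    (t a b : ℝ) : IntervalIntegrable (fun s => g (t + s)) volume a b := by
  simpa using (intervalIntegrable_of_locallyIntegrable hg (t + a) (t + b)).comp_add_left t

variable [NormedSpace ℝ E]

theorem mean_eq_integral (h : ℝ) (g : ℝ → E) (t : ℝ) :
    mean h g t = (1 / h) • ∫ x in t..(t + h), g x := by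
  simp [mean, intervalIntegral.integral_comp_add_left]

theorem continuous_mean (h : ℝ) {g : ℝ → E} (hg : LocallyIntegrable g volume) :
    Continuous (mean h g) := by
  have hc := intervalIntegral.continuous_primitive
    (fun a b => intervalIntegrable_of_locallyIntegrable hg a b) 0
  have : mean h g = fun t =>
      (1 / h) • ((∫ x in (0 : ℝ)..(t + h), g x) - ∫ x in (0 : ℝ)..t, g x) := by
    funext t
    rw [mean_eq_integral, intervalIntegral.integral_interval_sub_left] <;>
      exact intervalIntegrable_of_locallyIntegrable hg _ _
  rw [this]
  fun_prop

theorem mean_congr_ae (h : ℝ) {g g' : ℝ → E} (hgg : g =ᵐ[volume] g') : mean h g = mean h g' := by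
  funext t
  rw [mean_eq_integral, mean_eq_integral, intervalIntegral.integral_congr_ae]
  filter_upwards [hgg] with x hx _ using hx

theorem mean_translate (h c : ℝ) (g : ℝ → E) :
    mean h (fun t => g (t + c)) = fun t => mean h g (t + c) := by
  funext t
  simp only [mean, add_right_comm]

theorem mean_add (h : ℝ) {g g' : ℝ → E} (hg : LocallyIntegrable g volume)
    (hg' : LocallyIntegrable g' volume) :
    mean h (fun t => g t + g' t) = fun t => mean h g t + mean h g' t := by
  funext t
  simp only [mean]
  rw [intervalIntegral.integral_add (intervalIntegrable_shift hg _ _ _)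
    (intervalIntegrable_shift hg' _ _ _), smul_add]

theorem mean_clm [CompleteSpace E] (h : ℝ) {g : ℝ → E} (hg : LocallyIntegrable g volume)
    (T : E →L[ℝ] E) : mean h (fun t => T (g t)) = fun t => T (mean h g t) := by
  funext t
  simp only [mean]
  rw [T.intervalIntegral_comp_comm (intervalIntegrable_shift hg _ _ _), map_smul]

/-- An indefinite integral turns the means of its density into difference quotients. -/
theorem mean_eq_diff {u v : ℝ → E} (huv : ∀ a b : ℝ, u b - u a = ∫ x in a..b, v x) (h : ℝ) :
    mean h v = fun t => (1 / h) • (u (t + h) - u t) := by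
  funext t
  rw [mean_eq_integral, huv]

theorem mean_sub_self {h : ℝ} (hh : 0 < h) {u : ℝ → E} (hu : LocallyIntegrable u volume)
    [CompleteSpace E] (t : ℝ) :
    mean h u t - u t = (1 / h) • ∫ s in (0 : ℝ)..h, (u (t + s) - u t) := by
  rw [intervalIntegral.integral_sub (intervalIntegrable_shift hu _ _ _) (by simp), smul_sub]
  simp [mean, smul_smul, hh.ne']

/-- A pointwise bound for functions under a mean passes to the mean. -/
theorem norm_mean_integral_le {h : ℝ} (hh : 0 < h) {w : ℝ → E} {ε : ℝ}
    (hw : ∀ s ∈ Set.Icc 0 h, ‖w s‖ ≤ ε) : ‖(1 / h) • ∫ s in (0 : ℝ)..h, w s‖ ≤ ε := by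
  have := intervalIntegral.norm_integral_le_of_norm_le_const (a := 0) (b := h) (f := w) (C := ε)
    fun s hs => hw s (by rw [Set.uIoc_of_le hh.le] at hs; exact ⟨hs.1.le, hs.2⟩)
  rw [norm_smul, Real.norm_of_nonneg (by positivity)]
  calc 1 / h * _ ≤ 1 / h * (ε * |h - 0|) := by gcongr
    _ = ε := by rw [sub_zero, abs_of_pos hh]; field_simp

/-! ### Uniformly continuous functions -/

theorem uniformContinuous_mean {h : ℝ} (hh : 0 < h) {u : ℝ → E} (hu : UniformContinuous u) :
    UniformContinuous (mean h u) := by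
  refine uniformContinuous_of_shift fun ε hε => ?_
  obtain ⟨η, hη, H⟩ := shift_of_uniformContinuous hu hε
  refine ⟨η, hη, fun δ hδ t => ?_⟩
  have hi := hu.continuous.locallyIntegrable (μ := volume)
  rw [mean, mean, ← smul_sub, ← intervalIntegral.integral_sub
    (intervalIntegrable_shift hi _ _ _) (intervalIntegrable_shift hi _ _ _)]
  refine norm_mean_integral_le hh fun s _ => ?_
  rw [add_right_comm]
  exact H δ hδ _

/-- As `h` tends to `0`, the means of a uniformly continuous function converge to it uniformly. -/
theorem exists_mean_close [CompleteSpace E] {u : ℝ → E} (hu : UniformContinuous u) {ε : ℝ}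
    (hε : 0 < ε) : ∃ h > 0, ∀ t, ‖u t - mean h u t‖ ≤ ε := by
  obtain ⟨η, hη, H⟩ := shift_of_uniformContinuous hu hε
  refine ⟨η, hη, fun t => ?_⟩
  rw [norm_sub_rev, mean_sub_self hη (hu.continuous.locallyIntegrable)]
  exact norm_mean_integral_le hη fun s hs => H s (by rw [abs_of_nonneg hs.1]; exact hs.2) t

/-- A continuous function with uniformly continuous differences differs from its mean by a
uniformly continuous function. (The differences alone do not suffice: consider `t ^ 2`.) -/
theorem uniformContinuous_of_mean_of_diff [CompleteSpace E] {u : ℝ → E} (hu : Continuous u)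
    (hm : UniformContinuous (mean 1 u))
    (hd : ∀ s : ℝ, 0 < s → UniformContinuous fun t => u (t + s) - u t) :
    UniformContinuous u := by
  have hi := hu.locallyIntegrable (μ := volume)
  have hv : UniformContinuous fun t => mean 1 u t - u t := by
    refine uniformContinuous_of_shift fun ε hε => ?_
    obtain ⟨η, hη, H⟩ := exists_uniform_modulus hu hd (isCompact_Icc (a := 0) (b := 1)) hε
    refine ⟨η, hη, fun δ hδ t => ?_⟩
    rw [mean_sub_self one_pos hi, mean_sub_self one_pos hi, ← smul_sub,
      ← intervalIntegral.integral_sub ((by fun_prop : Continuous _).intervalIntegrable _ _)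
        ((by fun_prop : Continuous _).intervalIntegrable _ _)]
    refine norm_mean_integral_le one_pos fun s hs => ?_
    convert H s hs δ hδ t using 2
    rw [add_right_comm]
    abel
  simpa using hm.sub hv

/-! ### The classes of functions with iterated means in `C_u` -/

theorem meanClass_mono {A B : Set (ℝ → E)} (h : A ⊆ B) : meanClass A ⊆ meanClass B :=
  fun _ hg => ⟨hg.1, fun k hk => h (hg.2 k hk)⟩

theorem mem_meanClassIter_zero_Cu {g : ℝ → E} (hg : UniformContinuous g) :
    g ∈ meanClassIter 0 (Cu E) :=
  ⟨hg, hg.continuous.locallyIntegrable⟩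

theorem meanClass_Cu_eq : meanClass (Cu E) = meanClassIter 1 (Cu E) :=
  Set.Subset.antisymm (fun _ hg => ⟨hg.1, fun h hh => mem_meanClassIter_zero_Cu (hg.2 h hh)⟩)
    fun _ hg => ⟨hg.1, fun h hh => (hg.2 h hh).1⟩

theorem meanClassIter_Cu_subset_succ (p : ℕ) :
    meanClassIter p (Cu E) ⊆ meanClassIter (p + 1) (Cu E) := by
  induction p with
  | zero => exact fun g hg => ⟨hg.2, fun h hh => mem_meanClassIter_zero_Cu
      (uniformContinuous_mean hh hg.1)⟩
  | succ p ih => exact meanClass_mono ih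

theorem meanClassIter_Cu_mono : Monotone fun p => meanClassIter p (Cu E) :=
  monotone_nat_of_le_succ meanClassIter_Cu_subset_succ

theorem translate_mem_meanClassIter_Cu (c : ℝ) {p : ℕ} {g : ℝ → E}
    (hg : g ∈ meanClassIter p (Cu E)) : (fun t => g (t + c)) ∈ meanClassIter p (Cu E) := by
  induction p generalizing g with
  | zero => exact mem_meanClassIter_zero_Cu (UniformContinuous.comp hg.1
      (uniformContinuous_id.add uniformContinuous_const))
  | succ p ih =>
    refine ⟨locallyIntegrable_translate hg.1 c, fun h hh => ?_⟩
    rw [mean_translate]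
    exact ih (hg.2 h hh)

theorem add_mem_meanClassIter_Cu {p : ℕ} {g g' : ℝ → E}
    (hg : g ∈ meanClassIter p (Cu E)) (hg' : g' ∈ meanClassIter p (Cu E)) :
    (fun t => g t + g' t) ∈ meanClassIter p (Cu E) := by
  induction p generalizing g g' with
  | zero => exact mem_meanClassIter_zero_Cu (UniformContinuous.add hg.1 hg'.1)
  | succ p ih =>
    refine ⟨hg.1.add hg'.1, fun h hh => ?_⟩
    rw [mean_add h hg.1 hg'.1]
    exact ih (hg.2 h hh) (hg'.2 h hh)

theorem zero_mem_meanClassIter_Cu (p : ℕ) : (fun _ : ℝ => (0 : E)) ∈ meanClassIter p (Cu E) :=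
  meanClassIter_Cu_mono (Nat.zero_le p) (mem_meanClassIter_zero_Cu uniformContinuous_const)

theorem sum_mem_meanClassIter_Cu {p : ℕ} {ι : Type*} (S : Finset ι) {g : ι → ℝ → E}
    (hg : ∀ i ∈ S, g i ∈ meanClassIter p (Cu E)) :
    (fun t => ∑ i ∈ S, g i t) ∈ meanClassIter p (Cu E) := by
  classical
  induction S using Finset.induction_on with
  | empty => simpa using zero_mem_meanClassIter_Cu p
  | insert i S hi ih =>
    simp only [Finset.sum_insert hi]
    exact add_mem_meanClassIter_Cu (hg i (Finset.mem_insert_self _ _))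
      (ih fun j hj => hg j (Finset.mem_insert_of_mem hj))

/-- For `p ≥ 1`, membership depends only on the almost everywhere class. -/
theorem mem_meanClassIter_succ_congr_ae {A : Set (ℝ → E)} {p : ℕ} {g g' : ℝ → E}
    (h : g =ᵐ[volume] g') (hi : LocallyIntegrable g' volume)
    (hg : g ∈ meanClassIter (p + 1) A) : g' ∈ meanClassIter (p + 1) A :=
  ⟨hi, fun k hk => mean_congr_ae k h ▸ hg.2 k hk⟩

variable [CompleteSpace E]

theorem clm_mem_meanClassIter_Cu (T : E →L[ℝ] E) {p : ℕ} {g : ℝ → E}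
    (hg : g ∈ meanClassIter p (Cu E)) : (fun t => T (g t)) ∈ meanClassIter p (Cu E) := by
  induction p generalizing g with
  | zero => exact mem_meanClassIter_zero_Cu (T.uniformContinuous.comp hg.1)
  | succ p ih =>
    refine ⟨fun x => ?_, fun h hh => ?_⟩
    · obtain ⟨s, hs, hi⟩ := hg.1 x
      exact ⟨s, hs, T.integrable_comp hi⟩
    rw [mean_clm h hg.1]
    exact ih (hg.2 h hh)

theorem sub_mem_meanClassIter_Cu {p : ℕ} {g g' : ℝ → E}
    (hg : g ∈ meanClassIter p (Cu E)) (hg' : g' ∈ meanClassIter p (Cu E)) :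
    (fun t => g t - g' t) ∈ meanClassIter p (Cu E) := by
  simpa [sub_eq_add_neg] using add_mem_meanClassIter_Cu hg
    (clm_mem_meanClassIter_Cu (-ContinuousLinearMap.id ℝ E) hg')

theorem smul_mem_meanClassIter_Cu (c : ℝ) {p : ℕ} {g : ℝ → E}
    (hg : g ∈ meanClassIter p (Cu E)) : (fun t => c • g t) ∈ meanClassIter p (Cu E) :=
  clm_mem_meanClassIter_Cu (c • ContinuousLinearMap.id ℝ E) hg

/-- If a continuous function has uniformly continuous means of order `p + 1` and its differences
have them of order `p`, then order `p` is enough for the function itself. -/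
theorem mem_meanClassIter_Cu_of_diff {p : ℕ} {u : ℝ → E} (hu : Continuous u)
    (hm : u ∈ meanClassIter (p + 1) (Cu E))
    (hd : ∀ s : ℝ, 0 < s → (fun t => u (t + s) - u t) ∈ meanClassIter p (Cu E)) :
    u ∈ meanClassIter p (Cu E) := by
  induction p generalizing u with
  | zero => exact mem_meanClassIter_zero_Cu <|
      uniformContinuous_of_mean_of_diff hu (hm.2 1 one_pos).1 fun s hs => (hd s hs).1
  | succ p ih =>
    refine ⟨hm.1, fun h hh => ih (continuous_mean h hm.1) (hm.2 h hh) fun s hs => ?_⟩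
    have hds := (hd s hs).2 h hh
    have e : mean h (fun t => u (t + s) - u t) = fun t => mean h u (t + s) - mean h u t := by
      have ht := locallyIntegrable_translate hm.1 s
      have hn : LocallyIntegrable (fun t => (-ContinuousLinearMap.id ℝ E) (u t)) volume := by
        exact hm.1.neg
      have := mean_add h ht hn
      rw [mean_translate, mean_clm h hm.1] at this
      simpa [sub_eq_add_neg] using this
    rwa [e] at hds

/-! ### Indefinite integrals -/

/-- Passing to a density costs one mean. -/
theorem density_mem_meanClassIter_succ {p : ℕ} {u v : ℝ → E}
    (hv : LocallyIntegrable v volume) (huv : ∀ a b : ℝ, u b - u a = ∫ x in a..b, v x)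
    (hu : u ∈ meanClassIter p (Cu E)) : v ∈ meanClassIter (p + 1) (Cu E) := by
  refine ⟨hv, fun h _ => ?_⟩
  rw [mean_eq_diff huv]
  exact smul_mem_meanClassIter_Cu _
    (sub_mem_meanClassIter_Cu (translate_mem_meanClassIter_Cu h hu) hu)

omit [CompleteSpace E] in
theorem continuous_of_indefinite_integral {u v : ℝ → E}
    (hv : LocallyIntegrable v volume) (huv : ∀ a b : ℝ, u b - u a = ∫ x in a..b, v x) :
    Continuous u := by
  have hc := intervalIntegral.continuous_primitive
    (fun a b => intervalIntegrable_of_locallyIntegrable hv a b) 0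
  have : u = fun t => u 0 + ∫ x in (0 : ℝ)..t, v x := by
    funext t
    rw [← huv, add_sub_cancel]
  rw [this]
  fun_prop

/-- If an indefinite integral and its density have uniformly continuous means of order `p + 1`,
then order `p` is enough for the indefinite integral: its differences are multiples of means of
the density. -/
theorem indefinite_integral_mem_meanClassIter {p : ℕ} {u v : ℝ → E}
    (huv : ∀ a b : ℝ, u b - u a = ∫ x in a..b, v x)
    (hu : u ∈ meanClassIter (p + 1) (Cu E)) (hv : v ∈ meanClassIter (p + 1) (Cu E)) :
    u ∈ meanClassIter p (Cu E) := by
  refine mem_meanClassIter_Cu_of_diff (continuous_of_indefinite_integral hv.1 huv) hu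
    fun s hs => ?_
  have := smul_mem_meanClassIter_Cu s (hv.2 s hs)
  rw [mean_eq_diff huv] at this
  simpa [smul_smul, hs.ne'] using this

/-! ### Recurrence of uniformly continuous functions -/

/-- A uniformly continuous function is the uniform limit of its means, so it is recurrent as soon
as its iterated means are. -/
theorem mem_REC_of_mem_meanClassIter {p : ℕ} {u : ℝ → E} (hu : UniformContinuous u)
    (hr : u ∈ meanClassIter p (REC E)) : u ∈ REC E := by
  induction p generalizing u with
  | zero => exact hr.1
  | succ p ih =>
    refine isRecurrent_of_uniform_approx fun ε hε => ?_
    obtain ⟨h, hh, H⟩ := exists_mean_close hu hε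
    exact ⟨mean h u, ih (uniformContinuous_mean hh hu) (hr.2 h hh), H⟩

omit [CompleteSpace E] in
theorem density_mem_meanClass_REC {u v : ℝ → E}
    (hv : LocallyIntegrable v volume) (huv : ∀ a b : ℝ, u b - u a = ∫ x in a..b, v x)
    (hu : u ∈ REC E) : v ∈ meanClass (REC E) := by
  refine ⟨hv, fun h _ => ?_⟩
  rw [mean_eq_diff huv]
  exact IsRecurrent.const_smul_diff hu _ _

/-- A chain `Y 0, …, Y n` in which each function is an indefinite integral of the next. If `Y 0`
has uniformly continuous iterated means and the top function inherits the order `p + 1` from the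
lower ones, then the lower ones are uniformly continuous. -/
theorem uniformContinuous_of_chain {n s : ℕ} {Y : ℕ → ℝ → E}
    (hI : ∀ k < n, LocallyIntegrable (Y (k + 1)) volume ∧
      ∀ a b : ℝ, Y k b - Y k a = ∫ x in a..b, Y (k + 1) x)
    (h0 : Y 0 ∈ meanClassIter s (Cu E))
    (htop : ∀ p, (∀ k < n, Y k ∈ meanClassIter (p + 1) (Cu E)) →
      Y n ∈ meanClassIter (p + 1) (Cu E)) :
    ∀ k < n, UniformContinuous (Y k) := by
  have hup : ∀ k ≤ n, Y k ∈ meanClassIter (s + k) (Cu E) := by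
    intro k hk
    induction k with
    | zero => exact h0
    | succ k ih => exact density_mem_meanClassIter_succ (hI k hk).1 (hI k hk).2 (ih (by omega))
  have hdown : ∀ p, (∀ k < n, Y k ∈ meanClassIter p (Cu E)) →
      ∀ k < n, Y k ∈ meanClassIter 0 (Cu E) := by
    intro p
    induction p with
    | zero => exact id
    | succ p ih =>
      refine fun H => ih fun k hk => indefinite_integral_mem_meanClassIter (hI k hk).2 (H k hk) ?_
      rcases Nat.lt_or_eq_of_le (Nat.succ_le_of_lt hk) with h | h
      · exact H _ h
      · have := htop p H
        rwa [← h] at this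
  exact fun k hk => (hdown (s + n)
    (fun j hj => meanClassIter_Cu_mono (by omega) (hup j hj.le)) k hk).1

/-- In a chain of indefinite integrals whose members are uniformly continuous, recurrence climbs:
the means of each density are difference quotients of the function below it. -/
theorem recurrent_of_chain {n s : ℕ} {Y : ℕ → ℝ → E}
    (hI : ∀ k < n, LocallyIntegrable (Y (k + 1)) volume ∧
      ∀ a b : ℝ, Y k b - Y k a = ∫ x in a..b, Y (k + 1) x)
    (hu : ∀ k < n, UniformContinuous (Y k)) (h0 : Y 0 ∈ meanClassIter s (REC E)) :
    ∀ k < n, Y k ∈ REC E := by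
  intro k hk
  induction k with
  | zero => exact mem_REC_of_mem_meanClassIter (hu 0 hk) h0
  | succ k ih =>
    have hr := density_mem_meanClass_REC (hI k (by omega)).1 (hI k (by omega)).2 (ih (by omega))
    exact mem_REC_of_mem_meanClassIter (p := 1) (hu _ hk)
      ⟨hr.1, fun h hh => ⟨hr.2 h hh, (continuous_mean h hr.1).locallyIntegrable⟩⟩

/-! ### The system -/

section System

variable {X : Type*} [NormedAddCommGroup X] [NormedSpace ℂ X] {r : ℕ}

/-- The action of a matrix on `X^r` as a continuous linear map. -/
noncomputable def matrixActCLM (A : Matrix (Fin r) (Fin r) ℂ) : (Fin r → X) →L[ℝ] (Fin r → X) where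
  toFun := matrixAct A
  map_add' v w := by ext i; simp [matrixAct, Finset.sum_add_distrib]
  map_smul' c v := by
    ext i
    simp only [matrixAct, Pi.smul_apply, RingHom.id_apply, Finset.smul_sum]
    exact Finset.sum_congr rfl fun l _ => smul_comm _ _ _
  cont := by unfold matrixAct; fun_prop

theorem matrixAct_mul (A B : Matrix (Fin r) (Fin r) ℂ) (v : Fin r → X) :
    matrixAct (A * B) v = matrixAct A (matrixAct B v) := by
  ext i
  simp only [matrixAct, Matrix.mul_apply, Finset.sum_smul, Finset.smul_sum, smul_smul]
  exact Finset.sum_comm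

theorem matrixAct_one (v : Fin r → X) : matrixAct (1 : Matrix (Fin r) (Fin r) ℂ) v = v := by
  ext i
  simp [matrixAct, Matrix.one_apply]

theorem matrixAct_zero (v : Fin r → X) : matrixAct (0 : Matrix (Fin r) (Fin r) ℂ) v = 0 := by
  ext i
  simp [matrixAct]

theorem leading_isUnit_det {n m : ℕ} {t : Fin m → ℝ}
    {a : Fin m → Fin (n + 1) → Matrix (Fin r) (Fin r) ℂ} (hdet : LeadingNondegenerate t a)
    {j₀ : Fin m} (hlead : ∀ j : Fin m, j ≠ j₀ → a j (Fin.last n) = 0) :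
    IsUnit (a j₀ (Fin.last n)).det := by
  have := hdet 0
  simp only [Complex.ofReal_zero, mul_zero, zero_mul, Complex.exp_zero, one_smul] at this
  rw [Finset.sum_eq_single j₀ (fun j _ hj => hlead j hj) (by simp)] at this
  exact isUnit_iff_ne_zero.2 this

/-- The system solved for its leading derivative. -/
theorem IsSolution.leading_eq {n m : ℕ} {t : Fin m → ℝ}
    {a : Fin m → Fin (n + 1) → Matrix (Fin r) (Fin r) ℂ} {f y : ℝ → Fin r → X}
    (hy : IsSolution t a f y) {j₀ : Fin m} (hj₀ : t j₀ = 0)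
    (hlead : ∀ j : Fin m, j ≠ j₀ → a j (Fin.last n) = 0)
    (hdet : IsUnit (a j₀ (Fin.last n)).det) :
    (fun x => matrixActCLM (a j₀ (Fin.last n))⁻¹ (f x - ∑ k : Fin n, ∑ j : Fin m,
      matrixActCLM (a j k.castSucc) (iteratedDeriv (k : ℕ) y (x + t j))))
      =ᵐ[volume] iteratedDeriv n y := by
  filter_upwards [hy.2] with x hx
  rw [Fin.sum_univ_castSucc, Finset.sum_eq_single (s := Finset.univ) (a := j₀)
    (f := fun j => matrixAct (a j (Fin.last n)) (iteratedDeriv (Fin.last n : ℕ) y (x + t j)))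
    (fun j _ hj => by rw [hlead j hj, matrixAct_zero]) (by simp), hj₀, add_zero] at hx
  rw [← hx]
  simp only [Fin.val_castSucc, Fin.val_last]
  change matrixAct _ (_ + _ - ∑ k : Fin n, ∑ j : Fin m,
    matrixAct (a j k.castSucc) (iteratedDeriv (k : ℕ) y (x + t j))) = _
  rw [add_sub_cancel_left, ← matrixAct_mul, Matrix.nonsing_inv_mul _ hdet, matrixAct_one]

end System

end RecurrentSolutions

open RecurrentSolutions in
theorem proposition5p6 {X : Type*} [NormedAddCommGroup X] [NormedSpace ℂ X] [CompleteSpace X]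
    (n m r : ℕ) (hn : 1 ≤ n)
    (t : Fin m → ℝ) (ht : StrictMono t)
    (a : Fin m → Fin (n + 1) → Matrix (Fin r) (Fin r) ℂ)
    (hdet : RecurrentSolutions.LeadingNondegenerate t a)
    (j₀ : Fin m) (hj₀ : t j₀ = 0) (hlead : ∀ j : Fin m, j ≠ j₀ → a j (Fin.last n) = 0)
    (f y : ℝ → Fin r → X)
    (hy : RecurrentSolutions.IsSolution t a f y)
    (hf : f ∈ RecurrentSolutions.meanClass (RecurrentSolutions.Cu (Fin r → X)))
    (s s' : ℕ)
    (hyu : y ∈ RecurrentSolutions.meanClassIter s (RecurrentSolutions.Cu (Fin r → X)))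
    (hyr : y ∈ RecurrentSolutions.meanClassIter s' (RecurrentSolutions.REC (Fin r → X))) :
    (∀ k < n, iteratedDeriv k y ∈ RecurrentSolutions.REC (Fin r → X)) ∧
      iteratedDeriv n y ∈
        RecurrentSolutions.meanClass (RecurrentSolutions.REC (Fin r → X)) := by
  have hI := hy.1.2
  -- The equation bounds the order of the top derivative, but never below the order `1` of `f`.
  have htop : ∀ p, (∀ k < n, iteratedDeriv k y ∈ meanClassIter (p + 1) (Cu (Fin r → X))) →
      iteratedDeriv n y ∈ meanClassIter (p + 1) (Cu (Fin r → X)) := by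
    intro p H
    have hn' : n - 1 + 1 = n := by omega
    have hi : LocallyIntegrable (iteratedDeriv n y) volume := hn' ▸ (hI (n - 1) (by omega)).1
    refine mem_meanClassIter_succ_congr_ae
      (hy.leading_eq hj₀ hlead (leading_isUnit_det hdet hlead)) hi
      (clm_mem_meanClassIter_Cu _ (sub_mem_meanClassIter_Cu ?_ ?_))
    · rw [meanClass_Cu_eq] at hf
      exact meanClassIter_Cu_mono (by omega : 1 ≤ p + 1) hf
    · exact sum_mem_meanClassIter_Cu _ fun k _ => sum_mem_meanClassIter_Cu _ fun j _ =>
        clm_mem_meanClassIter_Cu _ (translate_mem_meanClassIter_Cu (t j) (H k k.2))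
  have hu := uniformContinuous_of_chain (Y := fun k => iteratedDeriv k y) hI
    (by simpa using hyu) htop
  have hr := recurrent_of_chain (Y := fun k => iteratedDeriv k y) hI hu (by simpa using hyr)
  refine ⟨hr, ?_⟩
  obtain ⟨k, rfl⟩ : ∃ k, n = k + 1 := ⟨n - 1, by omega⟩
  exact density_mem_meanClass_REC (hI k k.lt_succ_self).1 (hI k k.lt_succ_self).2
    (hr k k.lt_succ_self)
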